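/- All graphs are finite and simple, and the eigenvalues of a graph are those of its adjacency matrix, counted with multiplicity. A graph $G$ is a \emph{Salem graph} if either it is nonbipartite, has exactly one eigenvalue $\lambda>2$ and has no eigenvalue in $(-\infty,-2)$; or it is bipartite, has exactly one eigenvalue $\lambda>2$, and $-\lambda$ is its only eigenvalue in $(-\infty,-2)$. A Salem graph is \emph{trivial} if it is nonbipartite and $\lambda\in\mathbb Z$, or it is bipartite and $\lambda^2\in\mathbb Z$. For a nontrivial Salem graph $G$ let $\tau(G)$ be the larger real root $z$ of $z+1/z=\lambda$ if $G$ is nonbipartite, and of $\sqrt z+1/\sqrt z=\lambda$ if $G$ is bipartite. Let $T_{\mathrm{graph}}\subset\mathbb R$ be the set of all numbers $\tau(G)$, where $G$ runs through the nontrivial Salem graphs, and let $S_{\mathrm{graph}}$ (the set of graph Pisot numbers) be the set of limit points of $T_{\mathrm{graph}}$ in $\mathbb R$. The first derived set of a set $A\subset\mathbb R$ is the set of limit points of $A$ in $\mathbb R$, and for $j\ge 2$ its $j$-th derived set is the set of limit points of its $(j-1)$-th derived set. **Theorem.** Let $k\ge 1$ be an integer. Then $\bigl(k+\sqrt{k^2+4}\bigr)/2$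 belongs to the $(2k-1)$-th derived set of $S_{\mathrm{graph}}$, and $k+1$ belongs to the $(2k)$-th derived set of $S_{\mathrm{graph}}$. -/

import Mathlib

/-- The adjacency eigenvalues of a finite simple graph, counted with multiplicity. -/
noncomputable def graphEigenvalues {n : ℕ} (G : SimpleGraph (Fin n)) : Multiset ℝ :=
  open Classical in (G.adjMatrix ℝ).charpoly.roots

/-- `G` is a Salem graph whose unique eigenvalue greater than `2` is `lam`. -/
noncomputable def IsSalemGraphWith {n : ℕ} (G : SimpleGraph (Fin n)) (lam : ℝ) : Prop :=
  open Classical in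
  (graphEigenvalues G).filter (fun x => 2 < x) = {lam} ∧
    (¬ G.IsBipartite → (graphEigenvalues G).filter (fun x => x < -2) = 0) ∧
    (G.IsBipartite → (graphEigenvalues G).filter (fun x => x < -2) = {-lam})

/-- A Salem graph with largest eigenvalue `lam` is trivial if it is nonbipartite and `lam` is an
integer, or it is bipartite and `lam ^ 2` is an integer. -/
def IsTrivialSalem {n : ℕ} (G : SimpleGraph (Fin n)) (lam : ℝ) : Prop :=
  (¬ G.IsBipartite ∧ ∃ m : ℤ, lam = m) ∨ (G.IsBipartite ∧ ∃ m : ℤ, lam ^ 2 = m)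

/-- `t` is the number attached to the Salem graph `G` with largest eigenvalue `lam`: the larger root
of `z + 1 / z = lam` if `G` is nonbipartite, and of `√z + 1 / √z = lam` if `G` is bipartite. -/
def IsSalemNumberOf {n : ℕ} (G : SimpleGraph (Fin n)) (lam t : ℝ) : Prop :=
  (¬ G.IsBipartite → IsGreatest {z : ℝ | 0 < z ∧ z + 1 / z = lam} t) ∧
    (G.IsBipartite → IsGreatest {z : ℝ | 0 < z ∧ Real.sqrt z + 1 / Real.sqrt z = lam} t)

/-- The set of graph Salem numbers: the numbers attached to nontrivial Salem graphs. -/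
def graphSalemNumbers : Set ℝ :=
  {t : ℝ | ∃ (n : ℕ) (G : SimpleGraph (Fin n)) (lam : ℝ),
    IsSalemGraphWith G lam ∧ ¬ IsTrivialSalem G lam ∧ IsSalemNumberOf G lam t}

/-- The set of graph Pisot numbers: the limit points in `ℝ` of the set of graph Salem numbers. -/
def graphPisotNumbers : Set ℝ := derivedSet graphSalemNumbers

/-- The `j`-th derived set: apply the operation "set of limit points" `j` times. -/
def iteratedDerivedSet (j : ℕ) (A : Set ℝ) : Set ℝ := derivedSet^[j] A

/-! Take a tree with a centre joined to `k` hubs, two paths ("arms") hanging from each hub and one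
from the centre. Without the centre only paths remain, so vectors vanishing there have Rayleigh
quotient of absolute value at most 2, and at most one eigenvalue exceeds 2. Bipartiteness makes the
spectrum symmetric, so an eigenvalue above 2 makes the tree a Salem graph.

Eliminating arms and hubs from the eigenvalue equation leaves one scalar equation `treeDefect m lam
= 0`, in which an arm enters only through its `armRatio`, a finite continued fraction. These ratios
increase strictly to a limit as the arm grows, so infinite arms make sense formally. The defect is
strictly increasing in `lam`, and cutting an infinite arm raises it, so zeros for long finite arms
approach the zero for the infinite arm strictly from below. Each infinite arm thus gives one
derivation (`largerRoot_sq_mem_iteratedDerivedSet`).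

With `lam = q + 1/q` and `z = q ^ 2`, infinite hub arms and no centre arm give `z ^ 2 - 1 = k * z`,
using `2k` derivations; an infinite centre arm as well gives `z = k + 1`, using `2k + 1`. One
derivation is spent passing from graph Salem to graph Pisot numbers. -/

/-! ### Spectral criterion for bipartite Salem graphs -/

open Matrix in
/-- A symmetric matrix whose quadratic form is at most `2` on a coordinate hyperplane has at most
one eigenvalue above `2`. -/
lemma filter_eigenvalues_eq_singleton {V ι : Type*} [Fintype V] [Fintype ι] {A : Matrix V V ℝ}
    (hA : A.IsSymm) {e : ι → V → ℝ} {f : ι → ℝ} (horth : ∀ i j, i ≠ j → e i ⬝ᵥ e j = 0)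
    (hone : ∀ i, e i ⬝ᵥ e i = 1) (hcomplete : ∀ x, (∀ i, e i ⬝ᵥ x = 0) → x = 0)
    (he : ∀ i, A *ᵥ e i = f i • e i) (c : V)
    (hc : ∀ w : V → ℝ, w c = 0 → w ⬝ᵥ A *ᵥ w ≤ 2 * (w ⬝ᵥ w))
    {x : V → ℝ} (hx : x ≠ 0) {lam : ℝ} (hlam : 2 < lam) (hAx : A *ᵥ x = lam • x) :
    (Finset.univ.val.map f).filter (fun y => 2 < y) = {lam} := by
  classical
  obtain ⟨i, hi⟩ : ∃ i, e i ⬝ᵥ x ≠ 0 := by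
    by_contra! h
    exact hx (hcomplete x h)
  have hfi : f i = lam := by
    have h1 : e i ⬝ᵥ A *ᵥ x = (A *ᵥ e i) ⬝ᵥ x := by
      rw [dotProduct_mulVec, ← mulVec_transpose, hA.eq]
    rw [hAx, he, dotProduct_smul, smul_dotProduct, smul_eq_mul, smul_eq_mul] at h1
    exact (mul_right_cancel₀ hi h1).symm
  have huniq : ∀ j, 2 < f j → j = i := by
    intro j hj
    by_contra hji
    have hcj : e j c ≠ 0 := by
      intro h0
      have := hc (e j) h0
      rw [he, dotProduct_smul, hone, smul_eq_mul] at this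
      linarith
    -- This combination of the two eigenvectors vanishes at `c`, yet its Rayleigh quotient exceeds
    -- 2.
    have h1 := hc (e j c • e i - e i c • e j) (by simp [mul_comm])
    simp only [mulVec_sub, mulVec_smul, he, dotProduct_sub, sub_dotProduct, dotProduct_smul,
      smul_dotProduct, hone, horth i j (Ne.symm hji), horth j i hji, smul_eq_mul, hfi] at h1
    have h2 : 0 < e j c ^ 2 * (lam - 2) := mul_pos (by positivity) (by linarith)
    have h3 : 0 ≤ e i c ^ 2 * (f j - 2) := mul_nonneg (by positivity) (by linarith)
    nlinarith
  have : Finset.univ.filter (fun j => 2 < f j) = {i} := by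
    ext j
    simp only [Finset.mem_filter, Finset.mem_univ, true_and, Finset.mem_singleton]
    exact ⟨huniq j, fun h => by rw [h, hfi]; exact hlam⟩
  rw [Multiset.filter_map]
  have h4 := congrArg Finset.val this
  rw [Finset.filter_val] at h4
  have h5 : Finset.univ.val.filter ((fun y : ℝ => 2 < y) ∘ f) = {i} := by
    exact (Multiset.filter_congr fun _ _ => Iff.rfl).trans h4
  rw [h5, Multiset.map_singleton, hfi]

-- Apply `2|ab| ≤ a² + b²` to each entry and sum. As `y` is the indicator of the complement of `c`,
-- `A *ᵥ y` gives the row sums of `A` with column `c` removed.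
open Matrix in
lemma abs_quadraticForm_le {V : Type*} [Fintype V] {A : Matrix V V ℝ} (hA : A.IsSymm)
    (hA0 : ∀ u v, 0 ≤ A u v) {c : V} {y : V → ℝ} (hyc : y c = 0) (hy : ∀ v, v ≠ c → y v = 1)
    (hAy : ∀ v, v ≠ c → (A *ᵥ y) v ≤ 2) (w : V → ℝ) (hw : w c = 0) :
    |w ⬝ᵥ A *ᵥ w| ≤ 2 * (w ⬝ᵥ w) := by
  have hyw : ∀ v, y v * w v = w v := by
    intro v
    by_cases h : v = c
    · rw [h, hw, mul_zero]
    · rw [hy v h, one_mul]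
  have h1 : ∀ u v, |w u * (A u v * w v)| ≤
      (w u ^ 2 * (A u v * y v) + w v ^ 2 * (A v u * y u)) / 2 := by
    intro u v
    rw [hA.apply u v]
    by_cases hu : u = c
    · rw [hu, hw, hyc]; simp
    by_cases hv : v = c
    · rw [hv, hw, hyc]; simp
    rw [hy u hu, hy v hv, abs_le]
    have := hA0 u v
    constructor <;> nlinarith [mul_nonneg this (sq_nonneg (w u - w v)),
      mul_nonneg this (sq_nonneg (w u + w v))]
  have h2 : ∑ u, ∑ v, w u ^ 2 * (A u v * y v) ≤ 2 * (w ⬝ᵥ w) := by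
    rw [dotProduct, Finset.mul_sum]
    refine Finset.sum_le_sum fun u _ => ?_
    rw [← Finset.mul_sum]
    by_cases hu : u = c
    · rw [hu, hw]; simp
    · have := hAy u hu
      rw [mulVec, dotProduct] at this
      nlinarith [mul_le_mul_of_nonneg_left this (sq_nonneg (w u))]
  have h3 : ∑ u, ∑ v, w v ^ 2 * (A v u * y u) ≤ 2 * (w ⬝ᵥ w) := by
    rw [Finset.sum_comm]; exact h2
  calc |w ⬝ᵥ A *ᵥ w| = |∑ u, ∑ v, w u * (A u v * w v)| := by
        simp only [dotProduct, mulVec, Finset.mul_sum]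
    _ ≤ ∑ u, ∑ v, |w u * (A u v * w v)| :=
        (Finset.abs_sum_le_sum_abs _ _).trans
          (Finset.sum_le_sum fun u _ => Finset.abs_sum_le_sum_abs _ _)
    _ ≤ ∑ u, ∑ v, (w u ^ 2 * (A u v * y v) + w v ^ 2 * (A v u * y u)) / 2 :=
        Finset.sum_le_sum fun u _ => Finset.sum_le_sum fun v _ => h1 u v
    _ = (∑ u, ∑ v, w u ^ 2 * (A u v * y v) + ∑ u, ∑ v, w v ^ 2 * (A v u * y u)) / 2 := by
        simp only [← Finset.sum_div, ← Finset.sum_add_distrib]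
    _ ≤ 2 * (w ⬝ᵥ w) := by linarith

open Matrix Classical in
/-- A bipartite graph with an eigenvalue `lam > 2`, in which all vertices other than `c` have at most
two neighbours other than `c`, is a Salem graph. -/
lemma exists_isSalemGraphWith {V : Type*} [Fintype V] (G : SimpleGraph V) (hG : G.IsBipartite)
    {c : V} {y : V → ℝ} (hyc : y c = 0) (hy : ∀ v, v ≠ c → y v = 1)
    (hAy : ∀ v, v ≠ c → (G.adjMatrix ℝ *ᵥ y) v ≤ 2)
    {x : V → ℝ} (hx : x ≠ 0) {lam : ℝ} (hlam : 2 < lam) (hAx : G.adjMatrix ℝ *ᵥ x = lam • x) :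
    ∃ (n : ℕ) (G' : SimpleGraph (Fin n)), IsSalemGraphWith G' lam ∧ G'.IsBipartite := by
  set A := G.adjMatrix ℝ with hAdef
  have hA : A.IsSymm := G.isSymm_adjMatrix
  have hH : A.IsHermitian := by
    rw [IsHermitian, conjTranspose_eq_transpose_of_trivial]
    exact hA
  have hA0 : ∀ u v, 0 ≤ A u v := by
    intro u v
    rw [hAdef, SimpleGraph.adjMatrix_apply]
    split_ifs <;> norm_num
  have hq := abs_quadraticForm_le hA hA0 hyc hy hAy
  let e : V → V → ℝ := fun i => (hH.eigenvectorBasis i).ofLp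
  have hin : ∀ i (z : EuclideanSpace ℝ V), e i ⬝ᵥ z.ofLp = inner ℝ (hH.eigenvectorBasis i) z := by
    intro i z
    simp [e, PiLp.inner_apply, dotProduct, mul_comm]
  have horth : ∀ i j, i ≠ j → e i ⬝ᵥ e j = 0 := fun i j hij => by
    rw [hin]; exact hH.eigenvectorBasis.orthonormal.2 hij
  have hone : ∀ i, e i ⬝ᵥ e i = 1 := fun i => by
    rw [hin, real_inner_self_eq_norm_sq, hH.eigenvectorBasis.orthonormal.1 i, one_pow]
  have hcomplete : ∀ z, (∀ i, e i ⬝ᵥ z = 0) → z = 0 := by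
    intro z hz
    have h1 : WithLp.toLp 2 z = (0 : EuclideanSpace ℝ V) := by
      refine (LinearIsometryEquiv.map_eq_zero_iff hH.eigenvectorBasis.repr).1 ?_
      ext i
      rw [OrthonormalBasis.repr_apply_apply, ← hin]
      exact hz i
    exact congrArg WithLp.ofLp h1
  have he : ∀ i, A *ᵥ e i = hH.eigenvalues i • e i := hH.mulVec_eigenvectorBasis
  have hpos := filter_eigenvalues_eq_singleton hA horth hone hcomplete he c
    (fun w hw => (le_abs_self _).trans (hq w hw)) hx hlam hAx
  obtain ⟨C⟩ := hG
  -- Changing signs on one colour class turns a `lam`-eigenvector of `A` into one of `-A`, so the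
  -- criterion for the top eigenvalue also handles the bottom one.
  let s : V → ℝ := fun v => if C v = 0 then 1 else -1
  have hs0 : ∀ v, s v ≠ 0 := fun v => by simp only [s]; split_ifs <;> norm_num
  have hs : ∀ u v, G.Adj u v → s v = -s u := by
    intro u v huv
    have := C.valid huv
    simp only [s]
    split_ifs with h1 h2 h2
    · exact absurd (h2.trans h1.symm) this
    · norm_num
    · norm_num
    · omega
  have hneg := filter_eigenvalues_eq_singleton (A := -A) (f := fun i => -hH.eigenvalues i)
    (x := fun v => s v * x v) hA.neg horth hone hcomplete
    (fun i => by rw [neg_mulVec, he, neg_smul]) c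
    (fun w hw => by
      rw [neg_mulVec, dotProduct_neg]
      exact (neg_le_abs _).trans (hq w hw))
    (fun h => hx (funext fun v => by
      have := congrFun h v
      simpa [hs0 v] using this)) hlam (by
      ext v
      have h1 := congrFun hAx v
      simp only [mulVec, dotProduct, Pi.smul_apply, smul_eq_mul, Matrix.neg_apply] at h1 ⊢
      rw [mul_left_comm, ← h1, Finset.mul_sum]
      refine Finset.sum_congr rfl fun u _ => ?_
      rw [hAdef, SimpleGraph.adjMatrix_apply]
      split_ifs with h
      · rw [hs v u h]; ring
      · simp)
  have hroots : A.charpoly.roots = Finset.univ.val.map hH.eigenvalues :=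
    hH.roots_charpoly_eq_eigenvalues
  have hneg' : (Finset.univ.val.map hH.eigenvalues).filter (fun y => y < -2) = {-lam} := by
    rw [← Multiset.map_singleton (fun y : ℝ => -y), ← hneg, Multiset.filter_map,
      Multiset.filter_map, Multiset.map_map]
    refine Multiset.map_congr (Multiset.filter_congr fun i _ => ?_) fun i _ => (neg_neg _).symm
    simp only [Function.comp]
    constructor <;> intro h <;> linarith
  let F := G.overFinIso rfl
  have hG' : (G.overFin rfl).IsBipartite := ⟨C.comp F.symm.toHom⟩
  have hE : graphEigenvalues (G.overFin rfl) = Finset.univ.val.map hH.eigenvalues := by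
    rw [← hroots, graphEigenvalues, ← SimpleGraph.Iso.reindex_adjMatrix ℝ F, hAdef]
    congr 1
    convert Matrix.charpoly_reindex F.toEquiv (G.adjMatrix ℝ) <;> rfl
  refine ⟨_, G.overFin rfl, ⟨?_, fun h => absurd hG' h, fun _ => ?_⟩, hG'⟩
  · rw [hE, ← hpos]
  · rw [hE, ← hneg']

/-! ### The substitution `lam = q + 1 / q` -/

/-- The larger root `q` of `q + 1 / q = lam`. -/
noncomputable def largerRoot (lam : ℝ) : ℝ := (lam + Real.sqrt (lam ^ 2 - 4)) / 2

lemma largerRoot_gt_one {lam : ℝ} (h : 2 < lam) : 1 < largerRoot lam := by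
  unfold largerRoot
  have := Real.sqrt_nonneg (lam ^ 2 - 4)
  linarith

lemma largerRoot_add_inv {lam : ℝ} (h : 2 < lam) :
    largerRoot lam + 1 / largerRoot lam = lam := by
  have h1 := largerRoot_gt_one h
  have h2 : Real.sqrt (lam ^ 2 - 4) ^ 2 = lam ^ 2 - 4 := Real.sq_sqrt (by nlinarith)
  have h3 : largerRoot lam ≠ 0 := by positivity
  have h4 : largerRoot lam ^ 2 + 1 = lam * largerRoot lam := by
    unfold largerRoot
    linear_combination (1 / 4 : ℝ) * h2
  field_simp
  linarith

lemma largerRoot_of_add_inv {q : ℝ} (h : 1 < q) : largerRoot (q + 1 / q) = q := by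
  have h0 : 0 < q := by linarith
  have h1 : (q + 1 / q) ^ 2 - 4 = (q - 1 / q) ^ 2 := by field_simp; ring
  have h2 : 1 / q ≤ 1 := by rw [div_le_one h0]; exact h.le
  rw [largerRoot, h1, Real.sqrt_sq (by linarith)]
  ring

lemma two_lt_add_inv {q : ℝ} (h : 1 < q) : 2 < q + 1 / q := by
  have h0 : 0 < q := by linarith
  have h1 : q + 1 / q - 2 = (q - 1) ^ 2 / q := by field_simp; ring
  have h2 : 0 < (q - 1) ^ 2 / q := div_pos (pow_pos (by linarith) 2) h0
  linarith

lemma largerRoot_strictMono {x y : ℝ} (hx : 2 < x) (hxy : x < y) :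
    largerRoot x < largerRoot y := by
  unfold largerRoot
  have := Real.sqrt_le_sqrt (show x ^ 2 - 4 ≤ y ^ 2 - 4 by nlinarith)
  linarith

lemma continuous_largerRoot : Continuous largerRoot := by
  unfold largerRoot
  fun_prop

lemma isGreatest_largerRoot_sq {lam : ℝ} (h : 2 < lam) :
    IsGreatest {z : ℝ | 0 < z ∧ Real.sqrt z + 1 / Real.sqrt z = lam} (largerRoot lam ^ 2) := by
  have h1 := largerRoot_gt_one h
  have h0 : 0 < largerRoot lam := by linarith
  refine ⟨⟨by positivity, ?_⟩, ?_⟩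
  · rw [Real.sqrt_sq h0.le, largerRoot_add_inv h]
  · rintro z ⟨hz, hzl⟩
    have hs : 0 < Real.sqrt z := Real.sqrt_pos.2 hz
    rcases le_or_gt (Real.sqrt z) 1 with h2 | h2
    · rw [← Real.sq_sqrt hz.le]
      exact pow_le_pow_left₀ hs.le (by linarith) 2
    · rw [← hzl, largerRoot_of_add_inv h2, Real.sq_sqrt hz.le]

/-! ### Arm ratios and their limit -/

/-- The ratio of the values of a `lam`-eigenvector at the first vertex of an arm with `n` vertices
and at the vertex carrying the arm; `none` stands for the limit of infinitely long arms. -/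
noncomputable def armRatio : Option ℕ → ℝ → ℝ
  | some 0, _ => 0
  | some (n + 1), lam => 1 / (lam - armRatio (some n) lam)
  | none, lam => 1 / largerRoot lam

lemma armRatio_none_eq {lam : ℝ} (h : 2 < lam) :
    armRatio none lam = 1 / (lam - armRatio none lam) := by
  have := largerRoot_add_inv h
  rw [armRatio, show lam - 1 / largerRoot lam = largerRoot lam by linarith]

lemma armRatio_none_bounds {lam : ℝ} (h : 2 < lam) :
    0 < armRatio none lam ∧ armRatio none lam < 1 := by
  have h1 := largerRoot_gt_one h
  rw [armRatio]
  refine ⟨by positivity, ?_⟩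
  rw [div_lt_one (by linarith)]
  exact h1

lemma armRatio_some_bounds {lam : ℝ} (h : 2 < lam) (n : ℕ) :
    0 ≤ armRatio (some n) lam ∧ armRatio (some n) lam < armRatio none lam := by
  obtain ⟨h1, h2⟩ := armRatio_none_bounds h
  induction n with
  | zero => simpa [armRatio] using h1
  | succ n ih =>
    rw [armRatio_none_eq h, armRatio]
    refine ⟨?_, ?_⟩
    · exact one_div_nonneg.2 (by linarith)
    · exact one_div_lt_one_div_of_lt (by linarith) (by linarith)

lemma armRatio_bounds {lam : ℝ} (h : 2 < lam) (n : Option ℕ) :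
    0 ≤ armRatio n lam ∧ armRatio n lam < 1 := by
  obtain ⟨h1, h2⟩ := armRatio_none_bounds h
  cases n with
  | none => exact ⟨h1.le, h2⟩
  | some n => exact ⟨(armRatio_some_bounds h n).1, (armRatio_some_bounds h n).2.trans h2⟩

lemma armRatio_antitone {x y : ℝ} (hx : 2 < x) (hxy : x < y) (n : Option ℕ) :
    armRatio n y ≤ armRatio n x := by
  cases n with
  | none =>
    rw [armRatio, armRatio]
    have := largerRoot_gt_one hx
    exact one_div_le_one_div_of_le (by linarith) (largerRoot_strictMono hx hxy).le
  | some n =>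
    induction n with
    | zero => simp [armRatio]
    | succ n ih =>
      rw [armRatio, armRatio]
      have := (armRatio_bounds hx (some n)).2
      exact one_div_le_one_div_of_le (by linarith) (by linarith)

lemma continuousOn_armRatio (n : Option ℕ) : ContinuousOn (armRatio n) (Set.Ioi 2) := by
  cases n with
  | none =>
    refine ContinuousOn.congr (f := fun x => 1 / largerRoot x) ?_ fun x _ => by rw [armRatio]
    refine continuousOn_const.div continuous_largerRoot.continuousOn fun x hx => ?_
    have := largerRoot_gt_one hx
    positivity
  | some n =>
    induction n with
    | zero =>
      refine ContinuousOn.congr (f := fun _ => 0) continuousOn_const fun x _ => ?_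
      rw [armRatio.eq_1]
    | succ n ih =>
      refine ContinuousOn.congr (f := fun x => 1 / (x - armRatio (some n) x)) ?_
        fun x _ => by rw [armRatio]
      refine continuousOn_const.div (continuousOn_id.sub ih) fun x hx => ?_
      have h1 := (armRatio_bounds hx (some n)).2
      have h2 : (2 : ℝ) < x := hx
      exact (by linarith : (0 : ℝ) < x - armRatio (some n) x).ne'

/-- The limit `p < 1` is a fixed point of `r ↦ 1 / (lam - r)`, and each step shrinks the distance to
it by a factor of at most `p`. -/
lemma tendsto_armRatio {lam : ℝ} (h : 2 < lam) :
    Filter.Tendsto (fun n : ℕ => armRatio (some n) lam) Filter.atTop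
      (nhds (armRatio none lam)) := by
  obtain ⟨h0, h1⟩ := armRatio_none_bounds h
  set p := armRatio none lam with hp
  have key : ∀ n : ℕ, p - armRatio (some n) lam ≤ p ^ n * p := by
    intro n
    induction n with
    | zero => simp [armRatio]
    | succ n ih =>
      obtain ⟨h2, h3⟩ := armRatio_some_bounds h n
      obtain ⟨h4, h5⟩ := armRatio_some_bounds h (n + 1)
      rw [← hp] at h3 h5
      set r := armRatio (some n) lam
      have hr : armRatio (some (n + 1)) lam * (lam - r) = 1 := by
        rw [armRatio]
        exact one_div_mul_cancel (by linarith)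
      have hpe : p * (lam - p) = 1 := by
        have := armRatio_none_eq h
        rw [← hp] at this
        nth_rw 1 [this]
        exact one_div_mul_cancel (by linarith)
      set r' := armRatio (some (n + 1)) lam
      have e : p - r' = p * r' * (p - r) := by
        linear_combination r' * hpe - p * hr
      rw [e, pow_succ]
      have e1 : p * r' ≤ p := by nlinarith
      calc p * r' * (p - r) ≤ p * (p - r) := mul_le_mul_of_nonneg_right e1 (by linarith)
        _ ≤ p * (p ^ n * p) := mul_le_mul_of_nonneg_left ih h0.le
        _ = p ^ n * p * p := by ring
  have lim : Filter.Tendsto (fun n : ℕ => p - p ^ n * p) Filter.atTop (nhds (p - 0 * p)) :=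
    tendsto_const_nhds.sub
      ((tendsto_pow_atTop_nhds_zero_of_lt_one h0.le h1).mul tendsto_const_nhds)
  rw [zero_mul, sub_zero] at lim
  exact tendsto_of_tendsto_of_tendsto_of_le_of_le lim tendsto_const_nhds
    (fun n => by have := key n; linarith) fun n => (armRatio_some_bounds h n).2.le

/-! ### The defect function and its monotonicity -/

/-- The eigenvalue equation at the centre of the tree, after elimination of the arms and hubs;
`t` holds the ratios of the arms. -/
noncomputable def centreDefect {k : ℕ} (lam : ℝ) (t : Option (Fin k × Bool) → ℝ) : ℝ :=
  lam - t none - ∑ i, 1 / (lam - t (some (i, false)) - t (some (i, true)))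

/-- The function of `lam` whose zeros above `2` are the eigenvalues above `2` of the tree with arms
of lengths `m`. -/
noncomputable def treeDefect {k : ℕ} (m : Option (Fin k × Bool) → Option ℕ) (lam : ℝ) : ℝ :=
  centreDefect lam fun s => armRatio (m s) lam

section

variable {k : ℕ}

lemma centreDefect_le {x y : ℝ} {t u : Option (Fin k × Bool) → ℝ} (hx : 2 < x) (hxy : x ≤ y)
    (ht : ∀ s, t s < 1) (hut : ∀ s, u s ≤ t s) :
    centreDefect x t + (y - x) ≤ centreDefect y u := by
  have : ∑ i, 1 / (y - u (some (i, false)) - u (some (i, true))) ≤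
      ∑ i, 1 / (x - t (some (i, false)) - t (some (i, true))) := by
    refine Finset.sum_le_sum fun i _ => ?_
    have h1 := ht (some (i, false))
    have h2 := ht (some (i, true))
    have h3 := hut (some (i, false))
    have h4 := hut (some (i, true))
    exact one_div_le_one_div_of_le (by linarith) (by linarith)
  have h5 := hut none
  unfold centreDefect
  linarith

lemma centreDefect_lt {x : ℝ} {t u : Option (Fin k × Bool) → ℝ} (hx : 2 < x)
    (ht : ∀ s, t s < 1) (hut : ∀ s, u s ≤ t s) {s : Option (Fin k × Bool)} (hs : u s < t s) :
    centreDefect x t < centreDefect x u := by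
  have hle : ∀ i : Fin k, 1 / (x - u (some (i, false)) - u (some (i, true))) ≤
      1 / (x - t (some (i, false)) - t (some (i, true))) := by
    intro i
    have h1 := ht (some (i, false))
    have h2 := ht (some (i, true))
    have h3 := hut (some (i, false))
    have h4 := hut (some (i, true))
    exact one_div_le_one_div_of_le (by linarith) (by linarith)
  unfold centreDefect
  match s, hs with
  | none, hs =>
    have := Finset.sum_le_sum fun i (_ : i ∈ Finset.univ) => hle i
    linarith
  | some (i, b), hs =>
    have h0 := hut none
    have : ∑ i, 1 / (x - u (some (i, false)) - u (some (i, true))) <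
        ∑ i, 1 / (x - t (some (i, false)) - t (some (i, true))) := by
      refine Finset.sum_lt_sum (fun i _ => hle i) ⟨i, Finset.mem_univ _, ?_⟩
      have h1 := ht (some (i, false))
      have h2 := ht (some (i, true))
      have h3 := hut (some (i, false))
      have h4 := hut (some (i, true))
      refine one_div_lt_one_div_of_lt (by linarith) ?_
      cases b <;> linarith
    linarith

lemma treeDefect_strictMono (m : Option (Fin k × Bool) → Option ℕ) {x y : ℝ} (hx : 2 < x)
    (hxy : x < y) : treeDefect m x < treeDefect m y := by
  have := centreDefect_le (t := fun s => armRatio (m s) x) (u := fun s => armRatio (m s) y) hx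
    hxy.le (fun s => (armRatio_bounds hx _).2) fun s => armRatio_antitone hx hxy _
  unfold treeDefect
  linarith

lemma continuousOn_treeDefect (m : Option (Fin k × Bool) → Option ℕ) :
    ContinuousOn (treeDefect m) (Set.Ioi 2) := by
  unfold treeDefect centreDefect
  refine (continuousOn_id.sub (continuousOn_armRatio _)).sub
    (continuousOn_finsetSum _ fun i _ => continuousOn_const.div
      ((continuousOn_id.sub (continuousOn_armRatio _)).sub (continuousOn_armRatio _))
      fun x hx => ?_)
  have h1 := (armRatio_bounds hx (m (some (i, false)))).2
  have h2 := (armRatio_bounds hx (m (some (i, true)))).2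
  have h3 : (2 : ℝ) < x := hx
  dsimp only [id]
  linarith

lemma tendsto_treeDefect_update (m : Option (Fin k × Bool) → Option ℕ) {s : Option (Fin k × Bool)}
    (hs : m s = none) {lam : ℝ} (h : 2 < lam) :
    Filter.Tendsto (fun n : ℕ => treeDefect (Function.update m s (some n)) lam) Filter.atTop
      (nhds (treeDefect m lam)) := by
  have hu : ∀ s', Filter.Tendsto (fun n : ℕ => armRatio (Function.update m s (some n) s') lam)
      Filter.atTop (nhds (armRatio (m s') lam)) := by
    intro s'
    by_cases e : s' = s
    · subst e
      simpa [hs] using tendsto_armRatio h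
    · simp [e]
  unfold treeDefect centreDefect
  refine (tendsto_const_nhds.sub (hu _)).sub (tendsto_finsetSum _ fun i _ =>
    tendsto_const_nhds.div ((tendsto_const_nhds.sub (hu _)).sub (hu _)) ?_)
  have h1 := (armRatio_bounds h (m (some (i, false)))).2
  have h2 := (armRatio_bounds h (m (some (i, true)))).2
  linarith

lemma treeDefect_lt_update (m : Option (Fin k × Bool) → Option ℕ) {s : Option (Fin k × Bool)}
    (hs : m s = none) {lam : ℝ} (h : 2 < lam) (n : ℕ) :
    treeDefect m lam < treeDefect (Function.update m s (some n)) lam := by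
  refine centreDefect_lt h (fun s => (armRatio_bounds h _).2) (fun s' => ?_) (s := s) ?_
  · by_cases e : s' = s
    · subst e
      simpa [hs] using (armRatio_some_bounds h n).2.le
    · simp [e]
  · simpa [hs] using (armRatio_some_bounds h n).2

/-! ### Limit points from infinite arms -/

/-- Integers are discrete, so approximating zeros strictly below `lam` are eventually nontrivial,
even if `lam ^ 2` is an integer. -/
lemma eventually_sq_not_int (lam : ℝ) (h : 2 < lam) :
    ∀ᶠ x : ℝ in nhdsWithin lam (Set.Iio lam), ¬ ∃ z : ℤ, x ^ 2 = z := by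
  have h1 : ((⌈lam ^ 2⌉ - 1 : ℤ) : ℝ) < lam ^ 2 := by
    have := Int.ceil_lt_add_one (lam ^ 2)
    push_cast
    linarith
  have h2 : ∀ᶠ x in nhdsWithin lam (Set.Iio lam), ((⌈lam ^ 2⌉ - 1 : ℤ) : ℝ) < x ^ 2 :=
    nhdsWithin_le_nhds ((continuous_pow 2).continuousAt.eventually (lt_mem_nhds h1))
  have h3 : ∀ᶠ x in nhdsWithin lam (Set.Iio lam), (2 : ℝ) < x :=
    nhdsWithin_le_nhds (lt_mem_nhds h)
  filter_upwards [h2, h3, self_mem_nhdsWithin] with x hx hx2 hxl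
  rintro ⟨z, hz⟩
  have h4 : x ^ 2 < lam ^ 2 := by
    have : x < lam := hxl
    nlinarith
  rw [hz] at hx h4
  have h5 : z < ⌈lam ^ 2⌉ := Int.lt_ceil.2 h4
  have h6 : ⌈lam ^ 2⌉ - 1 < z := by exact_mod_cast hx
  omega

/-- If every tree with finite arms realizes its zeros above `2` in `T`, then a zero for a tree with
`j` infinite arms lies in the `j`-th derived set of `T`. -/
lemma largerRoot_sq_mem_iteratedDerivedSet {T : Set ℝ}
    (hT : ∀ (m : Option (Fin k × Bool) → Option ℕ) (lam : ℝ), (∀ s, m s ≠ none) → 2 < lam →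
      treeDefect m lam = 0 → (¬ ∃ z : ℤ, lam ^ 2 = z) → largerRoot lam ^ 2 ∈ T) (j : ℕ) :
    ∀ (m : Option (Fin k × Bool) → Option ℕ) (lam : ℝ),
      (Finset.univ.filter fun s => m s = none).card = j → 2 < lam → treeDefect m lam = 0 →
      (j = 0 → ¬ ∃ z : ℤ, lam ^ 2 = z) → largerRoot lam ^ 2 ∈ iteratedDerivedSet j T := by
  induction j with
  | zero =>
    intro m lam hm h2 h0 hz
    refine hT m lam (fun s hs => ?_) h2 h0 (hz rfl)
    rw [Finset.card_eq_zero, Finset.filter_eq_empty_iff] at hm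
    exact hm (Finset.mem_univ s) hs
  | succ j ih =>
    intro m lam hm h2 h0 _
    obtain ⟨s, hs⟩ := Finset.card_pos.1 (show 0 < _ by rw [hm]; omega)
    have hs' : m s = none := (Finset.mem_filter.1 hs).2
    have hcard : ∀ n : ℕ,
        (Finset.univ.filter fun s' => Function.update m s (some n) s' = none).card = j := by
      intro n
      have : (Finset.univ.filter fun s' => Function.update m s (some n) s' = none) =
          (Finset.univ.filter fun s' => m s' = none).erase s := by
        ext s'
        by_cases e : s' = s
        · subst e; simp
        · simp [e]
      rw [this, Finset.card_erase_of_mem hs, hm, Nat.add_sub_cancel]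
    rw [iteratedDerivedSet, Function.iterate_succ_apply', mem_derivedSet, accPt_iff_nhds]
    intro U hU
    have hU' : ∀ᶠ x in nhdsWithin lam (Set.Iio lam), largerRoot x ^ 2 ∈ U :=
      nhdsWithin_le_nhds ((continuous_largerRoot.pow 2).continuousAt.eventually hU)
    have h3 : ∀ᶠ x in nhdsWithin lam (Set.Iio lam), (2 : ℝ) < x :=
      nhdsWithin_le_nhds (lt_mem_nhds h2)
    obtain ⟨l, hl, hsub⟩ := mem_nhdsLT_iff_exists_Ioo_subset.1
      ((hU'.and h3).and (eventually_sq_not_int lam h2))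
    obtain ⟨x, hlx, hxl⟩ := exists_between (show l < lam from hl)
    have hx2 : 2 < x := (hsub ⟨hlx, hxl⟩).1.2
    have hneg : treeDefect m x < 0 := h0 ▸ treeDefect_strictMono m hx2 hxl
    -- For a long enough finite arm the defect is still negative at `x`, while at `lam` it is
    -- positive; the zero in between differs from `lam`.
    obtain ⟨n, hn⟩ := ((tendsto_treeDefect_update m hs' hx2).eventually
      (gt_mem_nhds hneg)).exists
    have hpos := treeDefect_lt_update m hs' h2 n
    rw [h0] at hpos
    obtain ⟨y, ⟨hxy, hyl⟩, hy⟩ := intermediate_value_Ioo hxl.le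
      ((continuousOn_treeDefect (Function.update m s (some n))).mono
        fun z hz => lt_of_lt_of_le hx2 hz.1) ⟨hn, hpos⟩
    obtain ⟨⟨hyU, hy2⟩, hyz⟩ := hsub ⟨hlx.trans hxy, hyl⟩
    refine ⟨largerRoot y ^ 2, ⟨hyU, ih _ y (hcard n) hy2 hy fun _ => hyz⟩, ?_⟩
    have h4 := largerRoot_strictMono hy2 hyl
    have h5 := largerRoot_gt_one hy2
    exact (pow_lt_pow_left₀ h4 (by linarith) two_ne_zero).ne

/-! ### The two limiting equations -/

lemma treeDefect_all_infinite {q : ℝ} (hq : 1 < q) (m : Option (Fin k × Bool) → Option ℕ)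
    (hm : ∀ p, m (some p) = none) :
    treeDefect m (q + 1 / q) = q + 1 / q - armRatio (m none) (q + 1 / q) - k * (q / (q ^ 2 - 1)) := by
  have h0 : 0 < q := by linarith
  have h1 : 0 < q ^ 2 - 1 := by nlinarith
  have h2 : 1 / (q + 1 / q - 1 / q - 1 / q) = q / (q ^ 2 - 1) := by
    rw [add_sub_cancel_right, div_eq_div_iff _ h1.ne']
    · field_simp
    · have : q - 1 / q = (q ^ 2 - 1) / q := by field_simp
      rw [this]
      positivity
  simp only [treeDefect, centreDefect, hm, show armRatio none (q + 1 / q) = 1 / q by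
    rw [armRatio, largerRoot_of_add_inv hq], h2, Finset.sum_const, Finset.card_univ,
    Fintype.card_fin, nsmul_eq_mul]

theorem derivedSet_membership {T : Set ℝ} (hk : 1 ≤ k)
    (hT : ∀ (m : Option (Fin k × Bool) → Option ℕ) (lam : ℝ), (∀ s, m s ≠ none) → 2 < lam →
      treeDefect m lam = 0 → (¬ ∃ z : ℤ, lam ^ 2 = z) → largerRoot lam ^ 2 ∈ T) :
    ((k : ℝ) + Real.sqrt ((k : ℝ) ^ 2 + 4)) / 2 ∈ iteratedDerivedSet (2 * k) T ∧
      (k : ℝ) + 1 ∈ iteratedDerivedSet (2 * k + 1) T := by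
  have hk' : (1 : ℝ) ≤ k := by exact_mod_cast hk
  constructor
  · set z : ℝ := ((k : ℝ) + Real.sqrt ((k : ℝ) ^ 2 + 4)) / 2 with hz
    have hs : Real.sqrt ((k : ℝ) ^ 2 + 4) ^ 2 = (k : ℝ) ^ 2 + 4 := Real.sq_sqrt (by positivity)
    have hs2 : (2 : ℝ) ≤ Real.sqrt ((k : ℝ) ^ 2 + 4) :=
      Real.le_sqrt_of_sq_le (by nlinarith)
    have hz1 : 1 < z := by rw [hz]; linarith
    have hzz : z ^ 2 - 1 = k * z := by
      rw [hz]; linear_combination (1 / 4 : ℝ) * hs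
    have hq : 1 < Real.sqrt z := Real.lt_sqrt_of_sq_lt (by simpa using hz1)
    have hq2 : Real.sqrt z ^ 2 = z := Real.sq_sqrt (by linarith)
    set q := Real.sqrt z
    -- The centre's arm is empty, leaving exactly the `2k` hub arms infinite.
    let m : Option (Fin k × Bool) → Option ℕ := fun s => if s = none then some 0 else none
    have hm := largerRoot_sq_mem_iteratedDerivedSet hT (2 * k) m (q + 1 / q) ?_
      (two_lt_add_inv hq) ?_ (by omega)
    · rwa [largerRoot_of_add_inv hq, hq2] at hm
    · have : (Finset.univ.filter fun s => m s = none) = Finset.univ.erase none := by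
        ext s; simp [m]
      rw [this, Finset.card_erase_of_mem (Finset.mem_univ _)]
      simp [mul_comm]
    · rw [treeDefect_all_infinite hq m fun p => by simp [m]]
      have h0 : 0 < q := by linarith
      have h1 : 0 < q ^ 2 - 1 := by nlinarith
      have : armRatio (m none) (q + 1 / q) = 0 := by simp [m, armRatio]
      rw [this]
      field_simp
      rw [hq2]
      linear_combination hzz
  · have hz1 : (1 : ℝ) < k + 1 := by linarith
    have hq : 1 < Real.sqrt (k + 1) := Real.lt_sqrt_of_sq_lt (by simpa using hz1)
    have hq2 : Real.sqrt ((k : ℝ) + 1) ^ 2 = k + 1 := Real.sq_sqrt (by linarith)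
    set q := Real.sqrt ((k : ℝ) + 1)
    have hm := largerRoot_sq_mem_iteratedDerivedSet hT (2 * k + 1) (fun _ => none) (q + 1 / q) ?_
      (two_lt_add_inv hq) ?_ (by omega)
    · rwa [largerRoot_of_add_inv hq, hq2] at hm
    · simp [mul_comm]
    · rw [treeDefect_all_infinite hq _ fun p => rfl]
      have h0 : 0 < q := by linarith
      have h1 : 0 < q ^ 2 - 1 := by nlinarith
      rw [armRatio, largerRoot_of_add_inv hq]
      field_simp
      rw [hq2]
      ring

end

/-! ### The tree and its adjacency operator -/

/-- The vertices of the tree: the centre `none`, the hubs, and the vertices of the arms, which have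
`m s` vertices each. -/
abbrev TreeVertex (k : ℕ) (m : Option (Fin k × Bool) → ℕ) : Type :=
  Option (Fin k) ⊕ (s : Option (Fin k × Bool)) × Fin (m s)

section

variable {k : ℕ} {m : Option (Fin k × Bool) → ℕ}

/-- The vertex that carries an arm: the centre or a hub. -/
def armHub : Option (Fin k × Bool) → Option (Fin k) := Option.map Prod.fst

/-- Adjacency in the tree. -/
def TreeAdj : TreeVertex k m → TreeVertex k m → Prop
  -- Exactly one of the two is the centre, so centre and hubs form a star.
  | .inl h, .inl h' => h = none ↔ h' ≠ none
  | .inl h, .inr ⟨s, j⟩ => armHub s = h ∧ j.val = 0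
  | .inr ⟨s, j⟩, .inl h => armHub s = h ∧ j.val = 0
  | .inr ⟨s, j⟩, .inr ⟨s', j'⟩ => s' = s ∧ (j'.val = j.val + 1 ∨ j.val = j'.val + 1)

lemma treeAdj_inl_inl {h h' : Option (Fin k)} :
    TreeAdj (m := m) (.inl h) (.inl h') ↔ (h = none ↔ h' ≠ none) :=
  ⟨id, id⟩

lemma treeAdj_inl_inr {h : Option (Fin k)} {s : Option (Fin k × Bool)} {j : Fin (m s)} :
    TreeAdj (.inl h) (.inr ⟨s, j⟩) ↔ armHub s = h ∧ j.val = 0 :=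
  ⟨id, id⟩

lemma treeAdj_inr_inl {h : Option (Fin k)} {s : Option (Fin k × Bool)} {j : Fin (m s)} :
    TreeAdj (.inr ⟨s, j⟩) (.inl h) ↔ armHub s = h ∧ j.val = 0 :=
  ⟨id, id⟩

lemma treeAdj_inr_inr {s s' : Option (Fin k × Bool)} {j : Fin (m s)} {j' : Fin (m s')} :
    TreeAdj (.inr ⟨s, j⟩) (.inr ⟨s', j'⟩) ↔
      s' = s ∧ (j'.val = j.val + 1 ∨ j.val = j'.val + 1) :=
  ⟨id, id⟩

/-- The tree with `k` hubs adjacent to the centre, two arms at each hub and one at the centre. -/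
def hubTree (k : ℕ) (m : Option (Fin k × Bool) → ℕ) : SimpleGraph (TreeVertex k m) where
  Adj := TreeAdj
  symm := ⟨by
    rintro (h | ⟨s, j⟩) (h' | ⟨s', j'⟩) hadj <;> simp only [TreeAdj] at hadj ⊢
    · tauto
    · exact hadj
    · exact hadj
    · exact ⟨hadj.1.symm, hadj.2.symm⟩⟩
  loopless := ⟨by
    rintro (h | ⟨s, j⟩) hadj <;> simp only [TreeAdj] at hadj
    · tauto
    · omega⟩

lemma hubTree_isBipartite : (hubTree k m).IsBipartite := by
  let C : TreeVertex k m → Bool := fun v => match v with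
    | .inl h => h.isSome
    | .inr ⟨s, j⟩ => (armHub s).isSome ^^ decide (j.val % 2 = 0)
  have hC : ∀ u v, (hubTree k m).Adj u v → C u ≠ C v := by
    rintro (h | ⟨s, j⟩) (h' | ⟨s', j'⟩) hadj <;> simp only [hubTree, TreeAdj] at hadj <;>
      simp only [C]
    · cases h <;> cases h' <;> simp_all
    · obtain ⟨rfl, h0⟩ := hadj
      cases armHub s' <;> simp [h0]
    · obtain ⟨rfl, h0⟩ := hadj
      cases armHub s <;> simp [h0]
    · obtain ⟨rfl, h0⟩ := hadj
      intro h
      have h1 : decide (j.val % 2 = 0) = decide (j'.val % 2 = 0) := by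
        simpa using h
      rw [decide_eq_decide] at h1
      omega
  let C' : (hubTree k m).Coloring Bool := SimpleGraph.Coloring.mk C fun {u v} h => hC u v h
  exact C'.colorable

/-- The values of `f` along an arm, starting at the vertex that carries it, and zero beyond. -/
def lineValue (f : TreeVertex k m → ℝ) (s : Option (Fin k × Bool)) : ℕ → ℝ
  | 0 => f (.inl (armHub s))
  | j + 1 => if h : j < m s then f (.inr ⟨s, ⟨j, h⟩⟩) else 0

lemma sum_fin_ite_val_eq {n : ℕ} (g : Fin n → ℝ) (a : ℕ) :
    ∑ j : Fin n, (if j.val = a then g j else 0) = if h : a < n then g ⟨a, h⟩ else 0 := by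
  split_ifs with h
  · rw [Finset.sum_eq_single (⟨a, h⟩ : Fin n)]
    · simp
    · intro j _ hj
      rw [if_neg fun e => hj (Fin.ext e)]
    · simp
  · refine Finset.sum_eq_zero fun j _ => if_neg ?_
    have := j.isLt
    omega

open Matrix Classical

lemma hubTree_mulVec (f : TreeVertex k m → ℝ) (v : TreeVertex k m) :
    ((hubTree k m).adjMatrix ℝ *ᵥ f) v =
      (∑ h, if TreeAdj v (.inl h) then f (.inl h) else 0) +
        ∑ s, ∑ j, if TreeAdj v (.inr ⟨s, j⟩) then f (.inr ⟨s, j⟩) else 0 := by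
  rw [mulVec, dotProduct, Fintype.sum_sum_type, Fintype.sum_sigma]
  simp only [SimpleGraph.adjMatrix_apply, ite_mul, one_mul, zero_mul]
  rfl

lemma sum_hub_arm (f : TreeVertex k m → ℝ) (h : Option (Fin k)) :
    (∑ s, ∑ j, if TreeAdj (.inl h) (.inr ⟨s, j⟩) then f (.inr ⟨s, j⟩) else 0) =
      ∑ s, if armHub s = h then lineValue f s 1 else 0 := by
  refine Finset.sum_congr rfl fun s _ => ?_
  simp only [treeAdj_inl_inr, ite_and]
  split_ifs with e
  · exact sum_fin_ite_val_eq (fun j => f (.inr ⟨s, j⟩)) 0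
  · simp

lemma hubTree_mulVec_centre (f : TreeVertex k m → ℝ) :
    ((hubTree k m).adjMatrix ℝ *ᵥ f) (.inl none) =
      ∑ i, f (.inl (some i)) + lineValue f none 1 := by
  rw [hubTree_mulVec, sum_hub_arm]
  simp [treeAdj_inl_inl, Fintype.sum_option, armHub]

lemma hubTree_mulVec_hub (f : TreeVertex k m → ℝ) (i : Fin k) :
    ((hubTree k m).adjMatrix ℝ *ᵥ f) (.inl (some i)) =
      f (.inl none) + (lineValue f (some (i, false)) 1 + lineValue f (some (i, true)) 1) := by
  rw [hubTree_mulVec, sum_hub_arm]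
  simp only [Fintype.sum_option, Fintype.sum_prod_type, Fintype.sum_bool, armHub,
    treeAdj_inl_inl]
  simp [Finset.sum_add_distrib, add_comm]

lemma hubTree_mulVec_arm (f : TreeVertex k m → ℝ) (s : Option (Fin k × Bool)) (j : Fin (m s)) :
    ((hubTree k m).adjMatrix ℝ *ᵥ f) (.inr ⟨s, j⟩) =
      lineValue f s j + lineValue f s (j + 2) := by
  rw [hubTree_mulVec, Finset.sum_eq_single (a := s)]
  · simp only [treeAdj_inr_inl, treeAdj_inr_inr, true_and]
    have h1 : ∀ j' : Fin (m s),
        (if j'.val = j.val + 1 ∨ j.val = j'.val + 1 then f (.inr ⟨s, j'⟩) else 0) =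
        (if j.val = j'.val + 1 then f (.inr ⟨s, j'⟩) else 0) +
          if j'.val = j.val + 1 then f (.inr ⟨s, j'⟩) else 0 := by
      intro j'
      by_cases h2 : j'.val = j.val + 1
      · simp [h2, show ¬ j.val = j.val + 1 + 1 by omega]
      · simp [h2]
    rw [Finset.sum_congr rfl fun j' _ => h1 j', Finset.sum_add_distrib,
      sum_fin_ite_val_eq (fun j' => f (.inr ⟨s, j'⟩)), ← add_assoc]
    congr 1
    -- The predecessor of the first arm vertex is the vertex carrying the arm; any other predecessor
    -- lies in the arm.
    rcases hj : j.val with _ | a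
    · simp [lineValue]
    · simp only [Nat.succ_ne_zero, and_false, if_false, Finset.sum_const_zero, zero_add,
        Nat.add_right_cancel_iff, lineValue, eq_comm (a := a)]
      exact sum_fin_ite_val_eq (fun j' => f (.inr ⟨s, j'⟩)) a
  · intro s' _ hs
    refine Finset.sum_eq_zero fun j' _ => if_neg ?_
    simp [treeAdj_inr_inr, hs]
  · simp

lemma hubTree_degree_le (v : TreeVertex k m) (hv : v ≠ .inl none) :
    ((hubTree k m).adjMatrix ℝ *ᵥ fun u => if u = .inl none then 0 else 1) v ≤ 2 := by
  have hL : ∀ s j, lineValue (fun u : TreeVertex k m => if u = .inl none then (0 : ℝ) else 1) s j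
      ≤ 1 := by
    intro s j
    cases j <;> simp only [lineValue] <;> split_ifs <;> norm_num
  rcases v with (_ | i) | ⟨s, j⟩
  · exact absurd rfl hv
  · rw [hubTree_mulVec_hub, if_pos rfl]
    linarith [hL (some (i, false)) 1, hL (some (i, true)) 1]
  · rw [hubTree_mulVec_arm]
    linarith [hL s j, hL s (j + 2)]

/-! ### The explicit eigenvector -/

/-- The value of the eigenvector at the centre (`1`) and the hubs. -/
noncomputable def hubValue (m : Option (Fin k × Bool) → ℕ) (lam : ℝ) : Option (Fin k) → ℝ
  | none => 1
  | some i => 1 / (lam - armRatio (some (m (some (i, false)))) lam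
      - armRatio (some (m (some (i, true)))) lam)

/-- The value of the eigenvector along an arm. -/
noncomputable def armEigenvector (m : Option (Fin k × Bool) → ℕ) (lam : ℝ)
    (s : Option (Fin k × Bool)) : ℕ → ℝ
  | 0 => hubValue m lam (armHub s)
  -- Beyond position `j` there remain `m s - j` vertices, a shorter arm carried by position `j`.
  | j + 1 => armRatio (some (m s - j)) lam * armEigenvector m lam s j

/-- The eigenvector of the tree. -/
noncomputable def treeEigenvector (m : Option (Fin k × Bool) → ℕ) (lam : ℝ) : TreeVertex k m → ℝ
  | .inl h => hubValue m lam h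
  | .inr ⟨s, j⟩ => armEigenvector m lam s (j + 1)

/-- The range includes `m s + 1`, one step past the end, where the empty-arm ratio 0 supplies the
boundary condition. -/
lemma lineValue_treeEigenvector (lam : ℝ) (s : Option (Fin k × Bool)) {j : ℕ}
    (hj : j ≤ m s + 1) :
    lineValue (treeEigenvector m lam) s j = armEigenvector m lam s j := by
  cases j with
  | zero => rfl
  | succ j =>
    rw [lineValue]
    split_ifs with h
    · rfl
    · have : m s - j = 0 := by omega
      rw [armEigenvector, this, armRatio, zero_mul]

lemma hubTree_mulVec_treeEigenvector {lam : ℝ} (h : 2 < lam)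
    (h0 : treeDefect (fun s => some (m s)) lam = 0) :
    (hubTree k m).adjMatrix ℝ *ᵥ treeEigenvector m lam = lam • treeEigenvector m lam := by
  ext v
  rw [Pi.smul_apply, smul_eq_mul]
  rcases v with (_ | i) | ⟨s, j⟩
  · rw [hubTree_mulVec_centre, lineValue_treeEigenvector _ _ (by omega)]
    simp only [treeDefect, centreDefect] at h0
    simp only [treeEigenvector, armEigenvector, hubValue, armHub, Option.map_none, Nat.sub_zero,
      mul_one]
    linarith
  · rw [hubTree_mulVec_hub, lineValue_treeEigenvector _ _ (by omega),
      lineValue_treeEigenvector _ _ (by omega)]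
    simp only [treeEigenvector, armEigenvector, armHub, Option.map_some, Nat.sub_zero]
    have h1 := (armRatio_bounds h (some (m (some (i, false))))).2
    have h2 := (armRatio_bounds h (some (m (some (i, true))))).2
    simp only [hubValue]
    have h3 : lam - armRatio (some (m (some (i, false)))) lam
      - armRatio (some (m (some (i, true)))) lam ≠ 0 := by linarith
    field_simp
    ring
  · have hj := j.isLt
    rw [hubTree_mulVec_arm, lineValue_treeEigenvector _ _ (by omega),
      lineValue_treeEigenvector _ _ (by omega)]
    simp only [treeEigenvector, armEigenvector]
    obtain ⟨d, hd⟩ : ∃ d, m s - j.val = d + 1 := ⟨m s - j.val - 1, by omega⟩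
    have hd' : m s - (j.val + 1) = d := by omega
    have h1 := (armRatio_bounds h (some d)).2
    have h2 : lam - armRatio (some d) lam ≠ 0 := by linarith
    rw [hd', hd, armRatio]
    field_simp
    ring

lemma mem_graphSalemNumbers_of_treeDefect (m : Option (Fin k × Bool) → Option ℕ) (lam : ℝ)
    (hm : ∀ s, m s ≠ none) (h : 2 < lam) (h0 : treeDefect m lam = 0)
    (hz : ¬ ∃ z : ℤ, lam ^ 2 = z) : largerRoot lam ^ 2 ∈ graphSalemNumbers := by
  obtain ⟨m', rfl⟩ : ∃ m' : Option (Fin k × Bool) → ℕ, m = fun s => some (m' s) := by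
    choose m' hm' using fun s => Option.ne_none_iff_exists'.1 (hm s)
    exact ⟨m', funext hm'⟩
  obtain ⟨n, G, hG, hb⟩ := exists_isSalemGraphWith (hubTree k m') hubTree_isBipartite
    (c := .inl none) (y := fun u => if u = .inl none then 0 else 1) (if_pos rfl)
    (fun v hv => if_neg hv) hubTree_degree_le (x := treeEigenvector m' lam)
    (fun e => one_ne_zero (congrFun e (.inl none))) h (hubTree_mulVec_treeEigenvector h h0)
  refine ⟨n, G, lam, hG, ?_, fun hn => absurd hb hn, fun _ => isGreatest_largerRoot_sq h⟩
  rintro (⟨hn, -⟩ | ⟨-, hi⟩)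
  · exact hn hb
  · exact hz hi

end

theorem mainTheorem6 (k : ℕ) (hk : 1 ≤ k) :
    ((k : ℝ) + Real.sqrt ((k : ℝ) ^ 2 + 4)) / 2 ∈ iteratedDerivedSet (2 * k - 1) graphPisotNumbers ∧
      (k : ℝ) + 1 ∈ iteratedDerivedSet (2 * k) graphPisotNumbers := by
  have h := derivedSet_membership hk (mem_graphSalemNumbers_of_treeDefect (k := k))
  rw [show 2 * k = 2 * k - 1 + 1 by omega] at h
  unfold iteratedDerivedSet at h ⊢
  -- The innermost derivation turns `graphSalemNumbers` into `graphPisotNumbers`.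
  rw [Function.iterate_succ_apply, Function.iterate_succ_apply] at h
  rwa [show 2 * k - 1 + 1 = 2 * k by omega] at h
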